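/- A set $Q\subseteq\mathbb{Q}$ is left-finite if for every $r\in\mathbb{Q}$ only finitely many elements of $Q$ are smaller than $r$. Let $\mathcal{R}$ (resp. $\mathcal{C}$) be the Levi-Civita field: the set of functions $a:\mathbb{Q}\to\mathbb{R}$ (resp. $\mathbb{C}$), $q\mapsto a[q]$, whose support $\operatorname{supp}(a)=\{q: a[q]\neq 0\}$ is left-finite, with $(a+b)[q]=a[q]+b[q]$ and $(ab)[q]=\sum_{q_1+q_2=q}a[q_1]b[q_2]$. Put $\lambda(a)=\min\operatorname{supp}(a)$, $\lambda(0)=\infty$; $a$ is at most finite if $\lambda(a)\ge 0$. For $a\in\mathcal{R}$ write $a\succeq 0$ if $a=0$ or $a[\lambda(a)]>0$; every $a\succeq0$ has a unique square root $\sqrt a\succeq 0$ in $\mathcal{R}$. For $z=a+ib\in\mathcal{C}$ with $a,b\in\mathcal{R}$ let $\overline z=a-ib$ and $|z|=\sqrt{a^2+b^2}$, and for $\mathbf{x}\in\mathcal{C}^n$ let $\|\mathbf{x}\|_2=\sqrt{|\mathbf{x}^1|^2+\dots+|\mathbf{x}^n|^2}\in\mathcal{R}$ and $\mathbf{x}^*=(\overline{\mathbf{x}^1},\dots,\overline{\mathbf{x}^n})$.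 A sequence $(a_k)$ is regular if $\bigcup_k\operatorname{supp}(a_k)$ is left-finite, and it converges weakly to $a$, written $a_k\xrightarrow{wk}a$, if for every real $r>0$ there is $N$ such that $\sup_{q\le 1/r}|a_k[q]-a[q]|<r$ for all $k>N$. **Proposition (power iteration for eigenvalues).** Let $A\in\mathcal{C}^{n\times n}$ be a diagonalizable matrix with at most finite entries, and let $\mathbf{v}\in\mathcal{C}^n$ be an eigenvector of $A$ with at most finite entries, corresponding to the eigenvalue $\nu\in\mathcal{C}$, with $\|\mathbf{v}\|_2[0]>0$. Let $(\mathbf{u}_k)_{k\in\mathbb{N}}\subset\mathcal{C}^n$ be a sequence of vectors with at most finite entries such that for each $i=1,\dots,n$ the sequence of entries $(\mathbf{u}_k^i)_k$ is regular and converges weakly to $\mathbf{v}^i$. Then $\|\mathbf{u}_k\|_2\neq 0$ for all sufficiently large $k$, and $$\frac{\mathbf{u}_k^*A\,\mathbf{u}_k}{\|\mathbf{u}_k\|_2^2}\xrightarrow{wk}\nu .$$ -/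

import Mathlib

noncomputable section

namespace LeviCivita

/-- A set of rationals is left-finite if below every rational it has only finitely many elements. -/
def LeftFinite (Q : Set ℚ) : Prop := ∀ r : ℚ, {q | q ∈ Q ∧ q < r}.Finite

theorem LeftFinite.mono {S T : Set ℚ} (hT : LeftFinite T) (h : S ⊆ T) : LeftFinite S :=
  fun r => (hT r).subset fun _ hq => ⟨h hq.1, hq.2⟩

theorem LeftFinite.union {S T : Set ℚ} (hS : LeftFinite S) (hT : LeftFinite T) :
    LeftFinite (S ∪ T) := fun r => ((hS r).union (hT r)).subset (by
  rintro q ⟨h | h, hr⟩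
  · exact Or.inl ⟨h, hr⟩
  · exact Or.inr ⟨h, hr⟩)

theorem LeftFinite.bddBelow {S : Set ℚ} (hS : LeftFinite S) : BddBelow S := by
  have h : BddBelow ({q | q ∈ S ∧ q < 0} ∪ Set.Ici 0) := (hS 0).bddBelow.union bddBelow_Ici
  refine h.mono fun q hq => ?_
  rcases lt_or_ge q 0 with h0 | h0
  · exact Or.inl ⟨hq, h0⟩
  · exact Or.inr h0

theorem LeftFinite.add {S T : Set ℚ} (hS : LeftFinite S) (hT : LeftFinite T) :
    LeftFinite {q | ∃ s ∈ S, ∃ t ∈ T, s + t = q} := by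
  obtain ⟨m, hm⟩ := hS.bddBelow
  obtain ⟨m', hm'⟩ := hT.bddBelow
  intro r
  refine ((hS (r - m')).image2 (fun s t => s + t) (hT (r - m))).subset ?_
  rintro q ⟨⟨s, hs, t, ht, rfl⟩, hr⟩
  have h1 := hm hs
  have h2 := hm' ht
  exact ⟨s, ⟨hs, by linarith⟩, t, ⟨ht, by linarith⟩, rfl⟩

/-- A set of rationals that is bounded below is left-finite as soon as finiteness below `r` always
propagates to finiteness below `r + δ`, for a fixed `δ > 0`. -/
theorem leftFinite_of_step {S : Set ℚ} (hb : BddBelow S) {δ : ℚ} (hδ : 0 < δ)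
    (step : ∀ r, {q | q ∈ S ∧ q < r}.Finite → {q | q ∈ S ∧ q < r + δ}.Finite) :
    LeftFinite S := by
  obtain ⟨m, hm⟩ := hb
  have key : ∀ n : ℕ, {q | q ∈ S ∧ q < m + n * δ}.Finite := by
    intro n
    induction n with
    | zero =>
      convert Set.finite_empty (α := ℚ)
      ext q
      simp only [Set.mem_ofPred_eq, Set.mem_empty_iff_false, iff_false, not_and, not_lt]
      intro hq
      have := hm hq
      push_cast
      linarith
    | succ n ih =>
      have h := step _ ih
      refine h.subset fun q hq => ⟨hq.1, ?_⟩
      have := hq.2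
      push_cast at this
      linarith
  intro r
  obtain ⟨n, hn⟩ := exists_nat_gt ((r - m) / δ)
  refine (key n).subset fun q hq => ⟨hq.1, ?_⟩
  rw [div_lt_iff₀ hδ] at hn
  linarith [hq.2]

/-- The least support point of a Hahn series is isolated. -/
theorem exists_gap {K : Type*} [Field K] (x : HahnSeries ℚ K) :
    ∃ δ : ℚ, 0 < δ ∧ ∀ p ∈ x.support, p ≠ x.order → x.order + δ ≤ p := by
  set S : Set ℚ := {p | p ∈ x.support ∧ p ≠ x.order} with hS
  have hwf : S.IsWF := x.isWF_support.mono fun p hp => hp.1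
  by_cases hne : S.Nonempty
  · refine ⟨hwf.min hne - x.order, ?_, fun p hp hp' => ?_⟩
    · have h := hwf.min_mem hne
      have h1 : x.order ≤ hwf.min hne := HahnSeries.order_le_of_coeff_ne_zero h.1
      have h2 := lt_of_le_of_ne h1 (Ne.symm h.2)
      linarith
    · have : hwf.min hne ≤ p := hwf.min_le hne ⟨hp, hp'⟩
      linarith
  · exact ⟨1, one_pos, fun p hp hp' => absurd ⟨p, hp, hp'⟩ hne⟩

theorem bddBelow_support {K : Type*} [Field K] (x : HahnSeries ℚ K) : BddBelow x.support :=
  ⟨x.order, fun _ hp => HahnSeries.order_le_of_coeff_ne_zero hp⟩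

theorem coeff_order_ne_zero {K : Type*} [Field K] {x : HahnSeries ℚ K} (hx : x ≠ 0) :
    x.coeff x.order ≠ 0 := by
  rw [← HahnSeries.leadingCoeff_eq]
  exact HahnSeries.leadingCoeff_ne_zero.2 hx

theorem leftFinite_support_inv {K : Type*} [Field K] {x : HahnSeries ℚ K}
    (hx : LeftFinite x.support) : LeftFinite (x⁻¹).support := by
  by_cases h0 : x = 0
  · subst h0
    simp [LeftFinite]
  obtain ⟨δ, hδ, hgap⟩ := exists_gap x
  obtain ⟨m, hm⟩ := bddBelow_support x⁻¹
  refine leftFinite_of_step ⟨m, hm⟩ hδ fun r hr => ?_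
  refine ((((hx (r + δ + x.order - m)).image2 (fun s t => s + t - x.order) hr)).insert
    (-x.order)).subset ?_
  rintro q ⟨hq, hqr⟩
  by_cases hq0 : q = -x.order
  · exact Or.inl hq0
  right
  have hex : ∃ p ∈ x.support, ∃ q' ∈ (x⁻¹).support, p + q' = x.order + q ∧ p ≠ x.order := by
    by_contra hcon
    push Not at hcon
    have h1 : (x * x⁻¹).coeff (x.order + q) = 0 := by
      rw [mul_inv_cancel₀ h0, HahnSeries.coeff_one, if_neg]
      intro h
      exact hq0 (by linarith)
    rw [HahnSeries.coeff_mul, Finset.sum_eq_single (x.order, q)] at h1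
    · rcases mul_eq_zero.1 h1 with h | h
      · exact coeff_order_ne_zero h0 h
      · exact hq h
    · rintro ⟨p, q'⟩ hpq hne
      rw [Finset.mem_antidiagonal] at hpq
      have := hcon p hpq.1 q' hpq.2.1 hpq.2.2
      have hp2 := hpq.2.2
      simp only at hp2
      exact absurd (Prod.ext this (by simp only; linarith)) hne
    · intro hn
      rw [Finset.mem_antidiagonal] at hn
      exact absurd ⟨coeff_order_ne_zero h0, hq, rfl⟩ hn
  obtain ⟨p, hp, q', hq', hsum, hne⟩ := hex
  have h1 := hgap p hp hne
  have h2 := hm hq'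
  exact ⟨p, ⟨hp, by linarith⟩, q', ⟨hq', by linarith⟩, by simp only; linarith⟩

/-- The Levi-Civita field over `K`: the functions `ℚ → K` with left-finite support, with
componentwise addition and convolution product, realised inside the Hahn series field (functions
`ℚ → K` with well-ordered support and the same operations). -/
def subfield (K : Type*) [Field K] : Subfield (HahnSeries ℚ K) where
  carrier := {x | LeftFinite x.support}
  zero_mem' := by simp [LeftFinite]
  one_mem' := fun r => (Set.finite_singleton (0 : ℚ)).subset fun q hq => by
    by_contra h
    exact hq.1 (by rw [HahnSeries.coeff_one]; exact if_neg h)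
  add_mem' := fun {x y} hx hy =>
    (LeftFinite.union hx hy).mono (HahnSeries.support_add_subset (x := x) (y := y))
  neg_mem' := fun {x} hx => by
    simpa only [Set.mem_ofPred_eq, HahnSeries.support_neg] using hx
  mul_mem' := fun {x y} hx hy => (LeftFinite.add hx hy).mono fun q hq =>
    Set.mem_add.1 (HahnSeries.support_mul_subset (x := x) (y := y) hq)
  inv_mem' := fun _ hx => leftFinite_support_inv hx

/-- The Levi-Civita field with coefficients in `K`, as a type. -/
abbrev LC (K : Type*) [Field K] : Type _ := subfield K

section Basic

variable {K : Type*} [Field K]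

/-- The value `a[q]`. -/
def coeff (a : LC K) (q : ℚ) : K := (a : HahnSeries ℚ K).coeff q

/-- The support of `a`. -/
def supp (a : LC K) : Set ℚ := {q | coeff a q ≠ 0}

theorem leftFinite_supp (a : LC K) : LeftFinite (supp a) := a.2

/-- Every function `ℚ → K` with left-finite support is an element of the Levi-Civita field. -/
def ofFun (f : ℚ → K) (hf : LeftFinite {q | f q ≠ 0}) : LC K :=
  ⟨{ coeff := f
     isPWO_support' := by
      refine Set.IsWF.isPWO ?_
      rw [Set.isWF_iff_no_descending_seq]
      intro g hg hmem
      refine Set.infinite_range_of_injective hg.injective (Set.Finite.subset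
        ((hf (g 0 + 1))) ?_)
      rintro _ ⟨n, rfl⟩
      have : g n ≤ g 0 := hg.antitone (Nat.zero_le n)
      exact ⟨hmem n, by linarith⟩ }, hf⟩

@[simp] theorem coeff_ofFun (f : ℚ → K) (hf : LeftFinite {q | f q ≠ 0}) (q : ℚ) :
    coeff (ofFun f hf) q = f q := rfl

@[ext] theorem ext {a b : LC K} (h : ∀ q, coeff a q = coeff b q) : a = b :=
  Subtype.ext (HahnSeries.ext (funext h))

/-- `λ(a)`, the minimum of the support of `a`, with `λ(0) = ∞`. -/
def lam (a : LC K) : WithTop ℚ := (a : HahnSeries ℚ K).orderTop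

/-- `a` is at most finite if `λ(a) ≥ 0`. -/
def AtMostFinite (a : LC K) : Prop := 0 ≤ lam a

/-- A sequence is regular if the union of the supports of its members is left-finite. -/
def Regular (a : ℕ → LC K) : Prop := LeftFinite (⋃ n, supp (a n))

/-- Apply an additive map to all values of `a`. -/
def mapCoeff {L : Type*} [Field L] (f : K →+ L) (a : LC K) : LC L :=
  ⟨(a : HahnSeries ℚ K).map f, a.2.mono fun q hq h => hq (by
    rw [HahnSeries.map_coeff, h, map_zero])⟩

@[simp] theorem coeff_mapCoeff {L : Type*} [Field L] (f : K →+ L) (a : LC K) (q : ℚ) :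
    coeff (mapCoeff f a) q = f (coeff a q) := rfl

end Basic

section Weak

variable {K : Type*} [NormedField K]

/-- The semi-norm `‖a‖_r = sup_{q ≤ r} |a[q]|`. -/
def seminorm (r : ℝ) (a : LC K) : ℝ := ⨆ q : {q : ℚ // (q : ℝ) ≤ r}, ‖coeff a q‖

/-- The supremum in the definition of the semi-norm is over a bounded set. -/
theorem bddAbove_seminorm (r : ℝ) (a : LC K) :
    BddAbove (Set.range fun q : {q : ℚ // (q : ℝ) ≤ r} => ‖coeff a q‖) := by
  obtain ⟨s, hs⟩ := exists_rat_gt r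
  refine (((leftFinite_supp a s).image fun q => ‖coeff a q‖).insert 0).bddAbove.mono ?_
  rintro _ ⟨⟨q, hq⟩, rfl⟩
  by_cases h : coeff a q = 0
  · exact Or.inl (by simp [h])
  · exact Or.inr ⟨q, ⟨h, by exact_mod_cast hq.trans_lt hs⟩, rfl⟩

/-- Weak convergence of the sequence `a` to `b`. -/
def WeakTendsto (a : ℕ → LC K) (b : LC K) : Prop :=
  ∀ r : ℝ, 0 < r → ∃ N : ℕ, ∀ n : ℕ, N < n → seminorm (1 / r) (a n - b) < r

end Weak

/-- `a ⪰ 0` in the real Levi-Civita field: `a = 0` or `a[λ(a)] > 0`. -/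
def Nonneg (a : LC ℝ) : Prop := a = 0 ∨ 0 < (a : HahnSeries ℚ ℝ).leadingCoeff

open Classical in
/-- The square root of `a` in the real Levi-Civita field: the unique `b ⪰ 0` with `b ^ 2 = a`,
for `a ⪰ 0` (and `0` if there is none). -/
def sqrt (a : LC ℝ) : LC ℝ :=
  if h : ∃ b : LC ℝ, Nonneg b ∧ b ^ 2 = a then h.choose else 0

theorem leftFinite_support_of_sq {y : HahnSeries ℚ ℝ} (hx : LeftFinite (y ^ 2).support) :
    LeftFinite y.support := by
  by_cases h0 : y = 0
  · subst h0
    simp [LeftFinite]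
  obtain ⟨δ, hδ, hgap⟩ := exists_gap y
  refine leftFinite_of_step (bddBelow_support y) hδ fun r hr => ?_
  refine (((hr.image2 (fun s t => s + t - y.order) hr).union
    ((hx (r + δ + y.order)).image fun s => s - y.order)).insert y.order).subset ?_
  rintro q ⟨hq, hqr⟩
  by_cases hq0 : q = y.order
  · exact Or.inl hq0
  right
  by_cases hex : ∃ p ∈ y.support, ∃ p' ∈ y.support,
      p + p' = y.order + q ∧ p ≠ y.order ∧ p' ≠ y.order
  · obtain ⟨p, hp, p', hp', hsum, hne, hne'⟩ := hex
    have h1 := hgap p hp hne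
    have h2 := hgap p' hp' hne'
    exact Or.inl ⟨p, ⟨hp, by linarith⟩, p', ⟨hp', by linarith⟩, by simp only; linarith⟩
  · right
    push Not at hex
    refine ⟨y.order + q, ⟨?_, by linarith⟩, by simp⟩
    have hord := coeff_order_ne_zero h0
    have hsub : ({(y.order, q), (q, y.order)} : Finset (ℚ × ℚ)) ⊆
        Finset.antidiagonal y.isPWO_support y.isPWO_support (y.order + q) := by
      intro z hz
      rw [Finset.mem_insert, Finset.mem_singleton] at hz
      rw [Finset.mem_antidiagonal]
      rcases hz with rfl | rfl
      · exact ⟨hord, hq, rfl⟩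
      · exact ⟨hq, hord, add_comm _ _⟩
    rw [HahnSeries.mem_support, sq, HahnSeries.coeff_mul, ← Finset.sum_subset hsub]
    · rw [Finset.sum_pair (fun h => hq0 (Prod.ext_iff.1 h).2)]
      have : y.coeff y.order * y.coeff q ≠ 0 := mul_ne_zero hord hq
      intro h
      apply this
      simp only at h
      linarith
    · rintro ⟨p, p'⟩ hmem hnot
      rw [Finset.mem_antidiagonal] at hmem
      obtain ⟨hp, hp', hsum⟩ := hmem
      simp only at hp hp' hsum
      exfalso
      apply hnot
      rw [Finset.mem_insert, Finset.mem_singleton]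
      by_cases hpo : p = y.order
      · left
        exact Prod.ext hpo (by simp only; linarith)
      · have h3 := hex p hp p' hp' hsum hpo
        right
        exact Prod.ext (by simp only; linarith) h3

theorem hsum_binomialFamily_one {w : HahnSeries ℚ ℝ} (hw : 0 < (w - 1).orderTop) :
    (HahnSeries.SummableFamily.binomialFamily w (1 : ℝ)).hsum = w := by
  have hz : ∀ n : ℕ, n ∉ ({0, 1} : Finset ℕ) →
      HahnSeries.SummableFamily.binomialFamily w (1 : ℝ) n = 0 := by
    intro n hn
    rw [HahnSeries.SummableFamily.binomialFamily_apply hw]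
    have h2 : 1 < n := by
      simp only [Finset.mem_insert, Finset.mem_singleton, not_or] at hn
      omega
    have h3 : Ring.choose (1 : ℝ) n = 0 := by
      have := Ring.choose_natCast (R := ℝ) 1 n
      rw [Nat.choose_eq_zero_of_lt h2] at this
      simpa using this
    rw [h3, zero_smul]
  ext g
  rw [HahnSeries.SummableFamily.coeff_hsum,
    finsum_eq_sum_of_support_subset (s := ({0, 1} : Finset ℕ))]
  · rw [Finset.sum_pair (by norm_num), HahnSeries.SummableFamily.binomialFamily_apply hw,
      HahnSeries.SummableFamily.binomialFamily_apply hw]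
    simp
  · intro n hn
    by_contra h
    exact hn (by simp only [hz n h, HahnSeries.coeff_zero])

theorem exists_sq_of_leadingCoeff_pos (x : HahnSeries ℚ ℝ) (hx : 0 < x.leadingCoeff) :
    ∃ y : HahnSeries ℚ ℝ, 0 < y.leadingCoeff ∧ y ^ 2 = x := by
  set w : HahnSeries ℚ ℝ := HahnSeries.single (-x.order) (x.leadingCoeff)⁻¹ * x with hwdef
  have hw : 0 < (w - 1).orderTop := by
    have h := HahnSeries.unit_aux x (inv_mul_cancel₀ hx.ne') (-x.order) (neg_add_cancel _)
    rw [← HahnSeries.orderTop_neg, neg_sub] at h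
    exact h
  set z := HahnSeries.toOrderTopSubOnePos hw with hz
  set s := z ^ (1 / 2 : ℝ) with hs
  have hss : s * s = z := by
    rw [hs, ← HahnSeries.pow_add]
    apply Subtype.ext
    apply Units.ext
    have h1 : (1 / 2 + 1 / 2 : ℝ) = 1 := by norm_num
    rw [h1]
    simpa [hz] using hsum_binomialFamily_one hw
  have hss' : (s : (HahnSeries ℚ ℝ)ˣ).val * (s : (HahnSeries ℚ ℝ)ˣ).val = w := by
    have := congrArg (fun t : HahnSeries.orderTopSubOnePos ℚ ℝ =>
      ((t : (HahnSeries ℚ ℝ)ˣ) : HahnSeries ℚ ℝ)) hss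
    simpa [hz] using this
  have hslc : (s : (HahnSeries ℚ ℝ)ˣ).val.leadingCoeff = 1 :=
    ((HahnSeries.orderTop_self_sub_one_pos_iff _).1 s.2).2
  refine ⟨HahnSeries.single (x.order / 2) (√x.leadingCoeff) * (s : (HahnSeries ℚ ℝ)ˣ).val,
    ?_, ?_⟩
  · rw [HahnSeries.leadingCoeff_mul, hslc, mul_one, HahnSeries.leadingCoeff_of_single]
    exact Real.sqrt_pos.2 hx
  · rw [mul_pow, sq (s : (HahnSeries ℚ ℝ)ˣ).val, hss', sq, HahnSeries.single_mul_single,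
      add_halves, Real.mul_self_sqrt hx.le, hwdef, ← mul_assoc, HahnSeries.single_mul_single,
      add_neg_cancel, mul_inv_cancel₀ hx.ne', HahnSeries.single_zero_one, one_mul]

/-- Every `a ⪰ 0` has a square root, and only one that is `⪰ 0`. -/
theorem sqrt_spec {a : LC ℝ} (ha : Nonneg a) : Nonneg (sqrt a) ∧ sqrt a ^ 2 = a := by
  have h : ∃ b : LC ℝ, Nonneg b ∧ b ^ 2 = a := by
    rcases ha with rfl | ha
    · exact ⟨0, Or.inl rfl, by simp⟩
    · obtain ⟨y, hy, hyx⟩ := exists_sq_of_leadingCoeff_pos _ ha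
      refine ⟨⟨y, leftFinite_support_of_sq (by rw [hyx]; exact a.2)⟩, Or.inr hy, ?_⟩
      exact Subtype.ext hyx
  rw [sqrt, dif_pos h]
  exact h.choose_spec

theorem sqrt_unique {a b : LC ℝ} (hb : Nonneg b) (h : b ^ 2 = a) : sqrt a = b := by
  have hex : ∃ b : LC ℝ, Nonneg b ∧ b ^ 2 = a := ⟨b, hb, h⟩
  have hs : Nonneg (sqrt a) ∧ sqrt a ^ 2 = a := by
    rw [sqrt, dif_pos hex]
    exact hex.choose_spec
  rcases sq_eq_sq_iff_eq_or_eq_neg.1 (hs.2.trans h.symm) with h1 | h1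
  · exact h1
  · rcases hs.1 with h2 | h2
    · rw [h2] at h1 ⊢
      exact (neg_eq_zero.1 h1.symm).symm
    · rcases hb with h3 | h3
      · rw [h1, h3, neg_zero]
      · rw [h1] at h2
        have : ((-b : LC ℝ) : HahnSeries ℚ ℝ).leadingCoeff
            = -(b : HahnSeries ℚ ℝ).leadingCoeff := by
          rw [Subfield.coe_neg, HahnSeries.leadingCoeff_neg]
        linarith

/-- The real part of `z = a + i b`, taken coefficientwise. -/
def re (z : LC ℂ) : LC ℝ := mapCoeff Complex.reAddGroupHom z

/-- The imaginary part of `z = a + i b`, taken coefficientwise. -/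
def im (z : LC ℂ) : LC ℝ := mapCoeff Complex.imAddGroupHom z

/-- The conjugate `a - i b` of `z = a + i b`. -/
def conj (z : LC ℂ) : LC ℂ := mapCoeff (starRingEnd ℂ : ℂ →+* ℂ).toAddMonoidHom z

/-- The embedding of the real into the complex Levi-Civita field. -/
def toComplex (a : LC ℝ) : LC ℂ := mapCoeff Complex.ofRealHom.toAddMonoidHom a

/-- The absolute value `|z| = √(a² + b²)` of `z = a + i b`. -/
def abs (z : LC ℂ) : LC ℝ := sqrt (re z ^ 2 + im z ^ 2)

/-- The `ℓ²`-norm `‖x‖₂ = √(|x¹|² + … + |xⁿ|²)`. -/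
def norm2 {n : ℕ} (x : Fin n → LC ℂ) : LC ℝ := sqrt (∑ i, abs (x i) ^ 2)

/-- `A` is diagonalizable: `A = P D P⁻¹` with `P` invertible and `D` diagonal. -/
def Diagonalizable {n : ℕ} (A : Matrix (Fin n) (Fin n) (LC ℂ)) : Prop :=
  ∃ (P : Matrix.GeneralLinearGroup (Fin n) (LC ℂ)) (D : Fin n → LC ℂ),
    A = (P : Matrix (Fin n) (Fin n) (LC ℂ)) * Matrix.diagonal D *
      ((P⁻¹ : Matrix.GeneralLinearGroup (Fin n) (LC ℂ)) : Matrix (Fin n) (Fin n) (LC ℂ))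

/-- The Rayleigh quotient `x* A x / ‖x‖₂²`. -/
def rayleigh {n : ℕ} (A : Matrix (Fin n) (Fin n) (LC ℂ)) (x : Fin n → LC ℂ) : LC ℂ :=
  ((fun i => conj (x i)) ⬝ᵥ (A.mulVec x)) / toComplex (norm2 x) ^ 2

end LeviCivita

end

noncomputable section

namespace LeviCivita

open Filter Topology

/-! At an eigenvector the Rayleigh quotient equals the eigenvalue: `A v = ν v` gives `v* A v = ν ·
v* v`, and `v* v` is the squared norm, nonzero because its value at `0` is. The claim is therefore
continuity of the Rayleigh quotient at `v` along the given sequence.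

For regular sequences weak convergence can be replaced by `RegTendsto`: coefficientwise convergence
with one left-finite set eventually containing all supports. Below any bound such a set has finitely
many points, so pointwise convergence there is uniform, which returns weak convergence at the end.
Inside a common support each coefficient of a product is a finite sum over a fixed index set, so
sums and products pass to the limit.

The essential case is `RegTendsto.inv`. If `a` is at most finite with `a[0] ≠ 0`, the support of
`a⁻¹` lies in the additive monoid generated by the positive exponents of `a`, and `a a⁻¹ = 1`
expresses each coefficient of `a⁻¹` through those at smaller exponents. This gives a common
left-finite support, and convergence follows by well-founded induction on the exponent. -/

theorem LeftFinite.isPWO {S : Set ℚ} (hS : LeftFinite S) : S.IsPWO := by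
  refine Set.IsWF.isPWO ?_
  rw [Set.isWF_iff_no_descending_seq]
  intro g hg hmem
  refine Set.infinite_range_of_injective hg.injective ((hS (g 0 + 1)).subset ?_)
  rintro _ ⟨n, rfl⟩
  have : g n ≤ g 0 := hg.antitone (Nat.zero_le n)
  exact ⟨hmem n, by linarith⟩

theorem LeftFinite.exists_pos_le {S : Set ℚ} (hS : LeftFinite S) (hpos : ∀ s ∈ S, 0 < s) :
    ∃ δ : ℚ, 0 < δ ∧ ∀ s ∈ S, δ ≤ s := by
  by_cases hne : S.Nonempty
  · exact ⟨hS.isPWO.isWF.min hne, hpos _ (hS.isPWO.isWF.min_mem hne),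
      fun s hs => hS.isPWO.isWF.min_le hne hs⟩
  · exact ⟨1, one_pos, fun s hs => absurd ⟨s, hs⟩ hne⟩

/-- The additive monoid generated by a left-finite set of positive rationals is left-finite. -/
theorem LeftFinite.addSubmonoid_closure {S : Set ℚ} (hS : LeftFinite S)
    (hpos : ∀ s ∈ S, 0 < s) : LeftFinite (AddSubmonoid.closure S : Set ℚ) := by
  obtain ⟨δ, hδ, hle⟩ := hS.exists_pos_le hpos
  have hnonneg : ∀ q ∈ AddSubmonoid.closure S, 0 ≤ q := fun q hq =>
    AddSubmonoid.closure_induction (fun s hs => (hpos s hs).le) le_rfl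
      (fun _ _ _ _ => add_nonneg) hq
  refine leftFinite_of_step ⟨0, hnonneg⟩ hδ fun r hr => ?_
  refine (((hS (r + δ)).image2 (fun s t => s + t) hr).insert 0).subset ?_
  rintro q ⟨hq, hqr⟩
  -- A nonzero element of the monoid splits off a generator `s ≥ δ`; what remains lies below `r`,
  -- where finiteness is already known.
  have hcases : q = 0 ∨ ∃ s ∈ S, ∃ t ∈ AddSubmonoid.closure S, s + t = q := by
    induction hq using AddSubmonoid.closure_induction_left with
    | zero => exact Or.inl rfl
    | add_left s hs t ht _ => exact Or.inr ⟨s, hs, t, ht, rfl⟩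
  rcases hcases with h | ⟨s, hs, t, ht, rfl⟩
  · exact Or.inl h
  · have h1 := hle s hs
    have h2 := hnonneg t ht
    exact Or.inr ⟨s, ⟨hs, by linarith⟩, t, ⟨ht, by linarith⟩, rfl⟩

/-! ### Coefficients of products and inverses -/

section Coeff

variable {K : Type*} [Field K]

@[simp] theorem coeff_zero (q : ℚ) : coeff (0 : LC K) q = 0 := rfl

@[simp] theorem coeff_add (a b : LC K) (q : ℚ) : coeff (a + b) q = coeff a q + coeff b q := rfl

@[simp] theorem coeff_sub (a b : LC K) (q : ℚ) : coeff (a - b) q = coeff a q - coeff b q := rfl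

theorem coeff_one (q : ℚ) : coeff (1 : LC K) q = if q = 0 then 1 else 0 := by
  refine (HahnSeries.coeff_one (Γ := ℚ) (R := K) (a := q)).trans ?_
  congr

/-- The index set depends only on `S` and `T`, so all members of a sequence with common support
share one finite sum and limits can be taken termwise. -/
theorem coeff_mul_of_supp_subset {S T : Set ℚ} (hS : S.IsPWO) (hT : T.IsPWO) {a b : LC K}
    (ha : supp a ⊆ S) (hb : supp b ⊆ T) (q : ℚ) :
    coeff (a * b) q = ∑ p ∈ Finset.antidiagonal hS hT q, coeff a p.1 * coeff b p.2 := by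
  refine (HahnSeries.coeff_mul (x := (a : HahnSeries ℚ K)) (y := (b : HahnSeries ℚ K))).trans ?_
  refine Finset.sum_subset (fun p hp => ?_) fun p hp hnot => ?_
  · rw [Finset.mem_antidiagonal] at hp ⊢
    exact ⟨ha hp.1, hb hp.2.1, hp.2.2⟩
  · rw [Finset.mem_antidiagonal] at hp hnot
    by_contra h
    exact hnot ⟨left_ne_zero_of_mul h, right_ne_zero_of_mul h, hp.2.2⟩

theorem atMostFinite_iff {a : LC K} : AtMostFinite a ↔ ∀ q ∈ supp a, 0 ≤ q := by
  constructor
  · intro h q hq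
    have h1 : lam a ≤ q := HahnSeries.orderTop_le_of_coeff_ne_zero hq
    exact_mod_cast h.trans h1
  · intro h
    refine HahnSeries.le_orderTop_iff_forall.2 fun q hq => ?_
    by_contra hne
    exact absurd (h q hne) (not_le.2 (by exact_mod_cast hq))

/-- A set containing the support of `a⁻¹`, where `a` is at most finite and not infinitely small. -/
theorem supp_inv_subset {M : AddSubmonoid ℚ} {a : LC K} (hM : supp a ⊆ M)
    (hnonneg : ∀ q ∈ supp a, 0 ≤ q) (h0 : coeff a 0 ≠ 0) : supp a⁻¹ ⊆ M := by
  have ha : a ≠ 0 := fun h => h0 (by rw [h, coeff_zero])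
  intro q hq
  refine Set.WellFoundedOn.induction (leftFinite_supp a⁻¹).isPWO.isWF hq
    (P := fun q => q ∈ M) ?_
  intro q hq ih
  -- If `q` lay outside `M`, only the pair `(0, q)` could contribute to `(a a⁻¹)[q]`: any other has
  -- `p > 0`, hence `p' < q` in `M` by induction, and then `q = p + p'` would be in `M`. So `a[0]
  -- a⁻¹[q] = 0`, a contradiction.
  by_contra hqM
  have h1 : coeff (a * a⁻¹) q = 0 := by
    rw [mul_inv_cancel₀ ha, coeff_one, if_neg]
    rintro rfl
    exact hqM M.zero_mem
  rw [coeff_mul_of_supp_subset (leftFinite_supp a).isPWO (leftFinite_supp a⁻¹).isPWO subset_rfl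
    subset_rfl, Finset.sum_eq_single (0, q)] at h1
  · exact mul_ne_zero h0 hq h1
  · rintro ⟨p, p'⟩ hp hne
    rw [Finset.mem_antidiagonal] at hp
    obtain ⟨hp, hp', hsum⟩ := hp
    simp only at hp hp' hsum
    have hp0 : p ≠ 0 := by
      rintro rfl
      exact hne (Prod.ext rfl (by simpa using hsum))
    have hpos : 0 < p := lt_of_le_of_ne (hnonneg p hp) hp0.symm
    exact absurd (hsum ▸ M.add_mem (hM hp) (ih p' hp' (by linarith))) hqM
  · intro hn
    rw [Finset.mem_antidiagonal] at hn
    exact absurd ⟨h0, hq, zero_add q⟩ hn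

/-- The recursion for the values of `a⁻¹`. -/
theorem coeff_inv {S : Set ℚ} (hS : S.IsPWO) {a : LC K} (ha : supp a ⊆ S)
    (hainv : supp a⁻¹ ⊆ S) (h0 : coeff a 0 ≠ 0) {q : ℚ} (hq : q ∈ S) :
    coeff a⁻¹ q = (coeff a 0)⁻¹ * (coeff (1 : LC K) q - ∑ p ∈ (Finset.antidiagonal hS hS q).erase (0, q),
      coeff a p.1 * coeff a⁻¹ p.2) := by
  have hane : a ≠ 0 := fun h => h0 (by rw [h, coeff_zero])
  have hmem : ((0 : ℚ), q) ∈ Finset.antidiagonal hS hS q :=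
    Finset.mem_antidiagonal.2 ⟨ha h0, hq, zero_add q⟩
  rw [← mul_inv_cancel₀ hane, coeff_mul_of_supp_subset hS hS ha hainv,
    ← Finset.add_sum_erase _ _ hmem, add_sub_cancel_right, inv_mul_cancel_left₀ h0]

end Coeff

/-! ### Regular coefficientwise convergence -/

section RegTendsto

variable {K : Type*} [NormedField K]

/-- Pointwise convergence of a sequence that is eventually regular. -/
def RegTendsto (a : ℕ → LC K) (b : LC K) : Prop :=
  (∃ T : Set ℚ, LeftFinite T ∧ ∀ᶠ k in atTop, supp (a k) ⊆ T) ∧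
    ∀ q, Tendsto (fun k => coeff (a k) q) atTop (𝓝 (coeff b q))

theorem supp_subset_of_tendsto {a : ℕ → LC K} {b : LC K} {T : Set ℚ}
    (hT : ∀ᶠ k in atTop, supp (a k) ⊆ T)
    (h : ∀ q, Tendsto (fun k => coeff (a k) q) atTop (𝓝 (coeff b q))) : supp b ⊆ T := by
  intro q hq
  obtain ⟨k, hk, hk'⟩ := (((h q).eventually_ne hq).and hT).exists
  exact hk' hk

theorem WeakTendsto.tendsto_coeff {a : ℕ → LC K} {b : LC K} (h : WeakTendsto a b) (q : ℚ) :
    Tendsto (fun k => coeff (a k) q) atTop (𝓝 (coeff b q)) := by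
  rw [Metric.tendsto_atTop]
  intro ε hε
  -- Small enough that `q ≤ 1 / r`, so the semi-norm at `1 / r` controls the coefficient at `q`.
  set r : ℝ := min ε (1 / (|(q : ℝ)| + 1)) with hr
  have hq1 : 0 < |(q : ℝ)| + 1 := by positivity
  have hrpos : 0 < r := lt_min hε (by positivity)
  have hqr : (q : ℝ) ≤ 1 / r := by
    rw [le_div_iff₀ hrpos]
    calc (q : ℝ) * r ≤ (|(q : ℝ)| + 1) * r := by
          gcongr
          linarith [le_abs_self (q : ℝ)]
      _ ≤ (|(q : ℝ)| + 1) * (1 / (|(q : ℝ)| + 1)) := by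
          gcongr
          exact min_le_right _ _
      _ = 1 := mul_one_div_cancel hq1.ne'
  obtain ⟨N, hN⟩ := h r hrpos
  refine ⟨N + 1, fun k hk => ?_⟩
  rw [dist_eq_norm, ← coeff_sub]
  calc ‖coeff (a k - b) q‖ ≤ seminorm (1 / r) (a k - b) :=
        le_ciSup (bddAbove_seminorm (1 / r) (a k - b)) ⟨q, hqr⟩
    _ < r := hN k hk
    _ ≤ ε := min_le_left _ _

theorem WeakTendsto.regTendsto {a : ℕ → LC K} {b : LC K} (h : WeakTendsto a b)
    (hreg : Regular a) : RegTendsto a b :=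
  ⟨⟨_, hreg, .of_forall fun k => Set.subset_iUnion (fun n => supp (a n)) k⟩, h.tendsto_coeff⟩

theorem RegTendsto.weakTendsto {a : ℕ → LC K} {b : LC K} (h : RegTendsto a b) :
    WeakTendsto a b := by
  obtain ⟨⟨T, hT, haT⟩, hlim⟩ := h
  have hbT := supp_subset_of_tendsto haT hlim
  intro r hr
  obtain ⟨s, hs⟩ := exists_rat_gt (1 / r)
  -- Only finitely many exponents of `T` matter, so the estimates hold simultaneously; outside `T`
  -- both coefficients vanish. The bound `r / 2` keeps the supremum strictly below `r`.
  have hfin : ∀ᶠ k in atTop, ∀ q ∈ {q | q ∈ T ∧ q < s}, ‖coeff (a k - b) q‖ < r / 2 := by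
    refine (hT s).eventually_all.2 fun q _ => ?_
    have := (hlim q).sub_const (coeff b q)
    rw [sub_self] at this
    simpa only [coeff_sub] using (tendsto_zero_iff_norm_tendsto_zero.1 this).eventually_lt_const
      (half_pos hr)
  obtain ⟨N, hN⟩ := eventually_atTop.1 (hfin.and haT)
  refine ⟨N, fun k hk => lt_of_le_of_lt (Real.iSup_le ?_ (half_pos hr).le) (half_lt_self hr)⟩
  obtain ⟨h1, h2⟩ := hN k hk.le
  rintro ⟨q, hq⟩
  by_cases hqT : q ∈ T
  · exact (h1 q ⟨hqT, by exact_mod_cast hq.trans_lt hs⟩).le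
  · have ha0 : coeff (a k) q = 0 := by_contra fun h => hqT (h2 h)
    have hb0 : coeff b q = 0 := by_contra fun h => hqT (hbT h)
    simp only [coeff_sub, ha0, hb0, sub_zero, norm_zero]
    exact (half_pos hr).le

theorem regTendsto_const (a : LC K) : RegTendsto (fun _ => a) a :=
  ⟨⟨_, leftFinite_supp a, .of_forall fun _ => subset_rfl⟩, fun _ => tendsto_const_nhds⟩

theorem RegTendsto.add {a a' : ℕ → LC K} {b b' : LC K} (h : RegTendsto a b)
    (h' : RegTendsto a' b') : RegTendsto (fun k => a k + a' k) (b + b') := by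
  obtain ⟨⟨T, hT, haT⟩, hlim⟩ := h
  obtain ⟨⟨T', hT', haT'⟩, hlim'⟩ := h'
  refine ⟨⟨T ∪ T', hT.union hT', ?_⟩, fun q => (hlim q).add (hlim' q)⟩
  filter_upwards [haT, haT'] with k hk hk'
  exact (HahnSeries.support_add_subset (x := (a k : HahnSeries ℚ K))
    (y := (a' k : HahnSeries ℚ K))).trans (Set.union_subset_union hk hk')

theorem RegTendsto.sum {ι : Type*} (s : Finset ι) {a : ℕ → ι → LC K} {b : ι → LC K}
    (h : ∀ i ∈ s, RegTendsto (fun k => a k i) (b i)) :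
    RegTendsto (fun k => ∑ i ∈ s, a k i) (∑ i ∈ s, b i) := by
  classical
  induction s using Finset.induction_on with
  | empty => simpa using regTendsto_const (0 : LC K)
  | insert i s hi ih =>
    simp only [Finset.sum_insert hi]
    exact (h i (Finset.mem_insert_self i s)).add
      (ih fun j hj => h j (Finset.mem_insert_of_mem hj))

theorem RegTendsto.mul {a a' : ℕ → LC K} {b b' : LC K} (h : RegTendsto a b)
    (h' : RegTendsto a' b') : RegTendsto (fun k => a k * a' k) (b * b') := by
  obtain ⟨⟨T, hT, haT⟩, hlim⟩ := h
  obtain ⟨⟨T', hT', haT'⟩, hlim'⟩ := h'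
  refine ⟨⟨_, hT.add hT', ?_⟩, fun q => ?_⟩
  · filter_upwards [haT, haT'] with k hk hk' q hq
    obtain ⟨s, hs, t, ht, hst⟩ := Set.mem_add.1 (HahnSeries.support_mul_subset
      (x := (a k : HahnSeries ℚ K)) (y := (a' k : HahnSeries ℚ K)) hq)
    exact ⟨s, hk hs, t, hk' ht, hst⟩
  · rw [coeff_mul_of_supp_subset hT.isPWO hT'.isPWO (supp_subset_of_tendsto haT hlim)
      (supp_subset_of_tendsto haT' hlim')]
    refine Tendsto.congr' ?_ (tendsto_finsetSum _ fun p _ => (hlim p.1).mul (hlim' p.2))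
    filter_upwards [haT, haT'] with k hk hk'
    exact (coeff_mul_of_supp_subset hT.isPWO hT'.isPWO hk hk' q).symm

theorem RegTendsto.map {L : Type*} [NormedField L] {f : K →+ L} (hf : Continuous f)
    {a : ℕ → LC K} {b : LC K} (h : RegTendsto a b) :
    RegTendsto (fun k => mapCoeff f (a k)) (mapCoeff f b) := by
  obtain ⟨⟨T, hT, haT⟩, hlim⟩ := h
  refine ⟨⟨T, hT, haT.mono fun k hk q hq => hk fun h0 => hq ?_⟩, fun q =>
    (hf.tendsto _).comp (hlim q)⟩
  rw [coeff_mapCoeff, h0, map_zero]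

/-- Inversion is continuous for regular sequences of at most finite elements whose limit is not
infinitely small. -/
theorem RegTendsto.inv {a : ℕ → LC K} {b : LC K} (h : RegTendsto a b)
    (hfin : ∀ k, AtMostFinite (a k)) (h0 : coeff b 0 ≠ 0) :
    RegTendsto (fun k => (a k)⁻¹) b⁻¹ := by
  obtain ⟨⟨T, hT, haT⟩, hlim⟩ := h
  have hanonneg : ∀ k, ∀ q ∈ supp (a k), 0 ≤ q := fun k => atMostFinite_iff.1 (hfin k)
  have hbnonneg : ∀ q ∈ supp b, 0 ≤ q :=
    supp_subset_of_tendsto (T := {q | 0 ≤ q}) (.of_forall hanonneg) hlim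
  -- One monoid for the whole sequence: it eventually contains the supports of `a k` and of `(a
  -- k)⁻¹`, and also those of `b` and `b⁻¹`.
  set M := AddSubmonoid.closure {q | q ∈ T ∧ 0 < q} with hMdef
  have hM : LeftFinite (M : Set ℚ) :=
    (hT.mono fun q hq => hq.1 : LeftFinite {q | q ∈ T ∧ 0 < q}).addSubmonoid_closure
      fun q hq => hq.2
  have hTM : ∀ q ∈ T, 0 ≤ q → q ∈ M := by
    intro q hq hq0
    rcases hq0.eq_or_lt with rfl | hpos
    · exact M.zero_mem
    · exact AddSubmonoid.subset_closure ⟨hq, hpos⟩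
  have hbM : supp b ⊆ M := fun q hq => hTM q (supp_subset_of_tendsto haT hlim hq) (hbnonneg q hq)
  have hbinvM := supp_inv_subset hbM hbnonneg h0
  have hev : ∀ᶠ k in atTop, supp (a k) ⊆ M ∧ supp (a k)⁻¹ ⊆ M ∧ coeff (a k) 0 ≠ 0 := by
    filter_upwards [haT, (hlim 0).eventually_ne h0] with k hk hk0
    have h1 : supp (a k) ⊆ M := fun q hq => hTM q (hk hq) (hanonneg k q hq)
    exact ⟨h1, supp_inv_subset h1 (hanonneg k) hk0, hk0⟩
  refine ⟨⟨M, hM, hev.mono fun k hk => hk.2.1⟩, fun q => ?_⟩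
  by_cases hq : q ∈ M
  -- With `(0, q)` erased, every pair in the recursion has `p > 0`, so it uses the inverse only at
  -- exponents `p' < q`.
  · refine Set.WellFoundedOn.induction hM.isPWO.isWF (SetLike.mem_coe.2 hq)
      (P := fun q => Tendsto (fun k => coeff (a k)⁻¹ q) atTop (𝓝 (coeff b⁻¹ q))) ?_
    intro q hq ih
    rw [coeff_inv hM.isPWO hbM hbinvM h0 hq]
    have hlim' : Tendsto (fun k => (coeff (a k) 0)⁻¹ * (coeff (1 : LC K) q -
        ∑ p ∈ (Finset.antidiagonal hM.isPWO hM.isPWO q).erase (0, q),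
          coeff (a k) p.1 * coeff (a k)⁻¹ p.2)) atTop (𝓝 ((coeff b 0)⁻¹ * (coeff (1 : LC K) q -
        ∑ p ∈ (Finset.antidiagonal hM.isPWO hM.isPWO q).erase (0, q),
          coeff b p.1 * coeff b⁻¹ p.2))) := by
      refine ((hlim 0).inv₀ h0).mul (tendsto_const_nhds.sub (tendsto_finsetSum _ ?_))
      rintro ⟨p, p'⟩ hp
      rw [Finset.mem_erase, Finset.mem_antidiagonal] at hp
      obtain ⟨hne, hp, hp', hsum⟩ := hp
      simp only at hp hp' hsum
      refine (hlim p).mul (ih p' hp' ?_)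
      have hp0 : p ≠ 0 := by
        rintro rfl
        exact hne (Prod.ext rfl (by simpa using hsum))
      have hpnonneg : 0 ≤ p := AddSubmonoid.closure_induction (fun s hs => hs.2.le) le_rfl
        (fun _ _ _ _ => add_nonneg) hp
      have := lt_of_le_of_ne hpnonneg hp0.symm
      linarith
    refine hlim'.congr' ?_
    filter_upwards [hev] with k hk
    exact (coeff_inv hM.isPWO hk.1 hk.2.1 hk.2.2 hq).symm
  · have hb0 : coeff b⁻¹ q = 0 := by_contra fun h => hq (hbinvM h)
    rw [hb0]
    refine tendsto_const_nhds.congr' ?_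
    filter_upwards [hev] with k hk
    exact (by_contra fun h => hq (hk.2.1 (Ne.symm h)) : (0 : K) = coeff (a k)⁻¹ q)

end RegTendsto

/-! ### Order, conjugation and the norm -/

/-- Transfers `⪰ 0` to the lexicographic order on Hahn series, whose ordered ring structure supplies
closure under sums and positivity of squares. -/
theorem nonneg_iff {a : LC ℝ} : Nonneg a ↔ 0 ≤ toLex (a : HahnSeries ℚ ℝ) := by
  rw [← HahnSeries.leadingCoeff_nonneg_iff, le_iff_lt_or_eq, or_comm]
  refine or_congr ?_ Iff.rfl
  rw [eq_comm (a := (0 : ℝ)), HahnSeries.leadingCoeff_eq_zero]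
  exact ⟨fun h => by simp [h], fun h => Subtype.ext h⟩

theorem Nonneg.add {a b : LC ℝ} (ha : Nonneg a) (hb : Nonneg b) : Nonneg (a + b) := by
  rw [nonneg_iff] at *
  exact add_nonneg ha hb

theorem nonneg_sq (a : LC ℝ) : Nonneg (a ^ 2) := by
  rw [nonneg_iff]
  exact sq_nonneg (toLex (a : HahnSeries ℚ ℝ))

theorem nonneg_sum {ι : Type*} (s : Finset ι) {a : ι → LC ℝ} (h : ∀ i ∈ s, Nonneg (a i)) :
    Nonneg (∑ i ∈ s, a i) :=
  Finset.sum_induction a Nonneg (fun _ _ => Nonneg.add) (Or.inl rfl) h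

theorem abs_sq (z : LC ℂ) : abs z ^ 2 = re z ^ 2 + im z ^ 2 :=
  (sqrt_spec ((nonneg_sq _).add (nonneg_sq _))).2

theorem norm2_sq {n : ℕ} (x : Fin n → LC ℂ) : norm2 x ^ 2 = ∑ i, abs (x i) ^ 2 :=
  (sqrt_spec (nonneg_sum _ fun _ _ => nonneg_sq _)).2

/-- `toComplex` as a ring homomorphism. -/
def toComplexHom : LC ℝ →+* LC ℂ where
  toFun := toComplex
  map_one' := by
    ext q
    simp only [toComplex, coeff_mapCoeff, coeff_one]
    split_ifs <;> simp
  map_mul' a b := Subtype.ext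
    (HahnSeries.map_mul (Complex.ofRealHom : ℝ →ₙ+* ℂ) (x := (a : HahnSeries ℚ ℝ))
      (y := (b : HahnSeries ℚ ℝ)))
  map_zero' := by ext q; simp [toComplex]
  map_add' a b := by ext q; simp [toComplex]

theorem toComplexHom_apply (a : LC ℝ) : toComplexHom a = toComplex a := rfl

/-- The imaginary unit of the complex Levi-Civita field. -/
def imagUnit : LC ℂ :=
  ⟨HahnSeries.C Complex.I, fun r => (Set.finite_singleton (0 : ℚ)).subset fun q hq => by
    by_contra h
    exact hq.1 (HahnSeries.coeff_single_of_ne h)⟩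

theorem imagUnit_mul_self : imagUnit * imagUnit = -1 := by
  refine Subtype.ext ?_
  change HahnSeries.C Complex.I * HahnSeries.C Complex.I = (-1 : HahnSeries ℚ ℂ)
  rw [← map_mul, Complex.I_mul_I, map_neg, map_one]

theorem coeff_imagUnit_mul (a : LC ℂ) (q : ℚ) :
    coeff (imagUnit * a) q = Complex.I * coeff a q := by
  change (HahnSeries.C Complex.I * (a : HahnSeries ℚ ℂ)).coeff q = _
  rw [HahnSeries.C_mul_eq_smul]
  rfl

theorem re_add_im (z : LC ℂ) : toComplex (re z) + imagUnit * toComplex (im z) = z := by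
  ext q
  rw [coeff_add, coeff_imagUnit_mul, mul_comm]
  exact Complex.re_add_im (coeff z q)

theorem re_sub_im (z : LC ℂ) : toComplex (re z) - imagUnit * toComplex (im z) = conj z := by
  ext q
  rw [coeff_sub, coeff_imagUnit_mul]
  refine Complex.ext ?_ ?_ <;> simp [toComplex, re, im, conj]

theorem conj_mul_self (z : LC ℂ) : conj z * z = toComplex (abs z ^ 2) := by
  rw [abs_sq, ← toComplexHom_apply, map_add, map_pow, map_pow]
  nth_rw 2 [← re_add_im z]
  rw [← re_sub_im]
  simp only [toComplexHom_apply]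
  linear_combination (-toComplex (im z) ^ 2) * imagUnit_mul_self

/-- Makes the denominator polynomial in the entries and their conjugates, so no square root has to
be passed to a limit. -/
theorem toComplex_norm2_sq {n : ℕ} (x : Fin n → LC ℂ) :
    toComplex (norm2 x) ^ 2 = ∑ i, conj (x i) * x i := by
  rw [← toComplexHom_apply, ← map_pow, norm2_sq, map_sum]
  exact Finset.sum_congr rfl fun i _ => (conj_mul_self (x i)).symm

/-! ### At most finite elements -/

section AtMostFinite

variable {K : Type*} [Field K]

theorem AtMostFinite.add {a b : LC K} (ha : AtMostFinite a) (hb : AtMostFinite b) :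
    AtMostFinite (a + b) :=
  (le_min ha hb).trans HahnSeries.min_orderTop_le_orderTop_add

theorem AtMostFinite.mul {a b : LC K} (ha : AtMostFinite a) (hb : AtMostFinite b) :
    AtMostFinite (a * b) :=
  (add_nonneg ha hb).trans_eq
    (HahnSeries.orderTop_mul (a : HahnSeries ℚ K) (b : HahnSeries ℚ K)).symm

theorem atMostFinite_sum {ι : Type*} (s : Finset ι) {a : ι → LC K}
    (h : ∀ i ∈ s, AtMostFinite (a i)) : AtMostFinite (∑ i ∈ s, a i) :=
  Finset.sum_induction a AtMostFinite (fun _ _ => AtMostFinite.add)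
    (atMostFinite_iff.2 fun _ hq => absurd rfl hq) h

theorem AtMostFinite.map {L : Type*} [Field L] (f : K →+ L) {a : LC K} (ha : AtMostFinite a) :
    AtMostFinite (mapCoeff f a) := by
  rw [atMostFinite_iff] at *
  exact fun q hq => ha q fun h => hq (by rw [coeff_mapCoeff, h, map_zero])

theorem AtMostFinite.of_sq {a : LC K} (h : AtMostFinite (a ^ 2)) : AtMostFinite a := by
  by_contra hneg
  have hlt : lam a < 0 := not_le.1 hneg
  have h2 : lam (a ^ 2) = lam a + lam a := by
    rw [sq]
    exact HahnSeries.orderTop_mul (a : HahnSeries ℚ K) (a : HahnSeries ℚ K)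
  have h3 : (0 : WithTop ℚ) ≤ lam a + lam a := h2 ▸ h
  exact absurd h3 (not_le.2 (add_neg_of_neg_of_nonpos hlt hlt.le))

/-- Taking the value at `0` is multiplicative on at most finite elements. -/
theorem AtMostFinite.coeff_mul_zero {a b : LC K} (ha : AtMostFinite a) (hb : AtMostFinite b) :
    coeff (a * b) 0 = coeff a 0 * coeff b 0 := by
  rw [coeff_mul_of_supp_subset (leftFinite_supp a).isPWO (leftFinite_supp b).isPWO subset_rfl
    subset_rfl]
  rw [atMostFinite_iff] at ha hb
  -- Two nonnegative exponents add up to `0` only if both are `0`.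
  refine Finset.sum_eq_single ((0 : ℚ), (0 : ℚ)) ?_ fun hn => ?_
  · rintro ⟨p, p'⟩ hp hne
    rw [Finset.mem_antidiagonal] at hp
    obtain ⟨hp, hp', hsum⟩ := hp
    have h1 := ha p hp
    have h2 := hb p' hp'
    simp only at hsum
    exact absurd (Prod.ext (by simp only; linarith) (by simp only; linarith)) hne
  · by_contra h
    exact hn (Finset.mem_antidiagonal.2
      ⟨left_ne_zero_of_mul h, right_ne_zero_of_mul h, add_zero 0⟩)

end AtMostFinite

theorem atMostFinite_norm2 {n : ℕ} {x : Fin n → LC ℂ} (hx : ∀ i, AtMostFinite (x i)) :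
    AtMostFinite (norm2 x) := by
  refine AtMostFinite.of_sq ?_
  rw [norm2_sq]
  refine atMostFinite_sum _ fun i _ => ?_
  rw [abs_sq, sq, sq]
  exact (((hx i).map _).mul ((hx i).map _)).add (((hx i).map _).mul ((hx i).map _))

theorem coeff_toComplex_norm2_sq_ne_zero {n : ℕ} {x : Fin n → LC ℂ}
    (hx : ∀ i, AtMostFinite (x i)) (h0 : coeff (norm2 x) 0 ≠ 0) :
    coeff (toComplex (norm2 x) ^ 2) 0 ≠ 0 := by
  have h : AtMostFinite (toComplex (norm2 x)) := (atMostFinite_norm2 hx).map _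
  rw [sq, h.coeff_mul_zero h]
  exact mul_self_ne_zero.2 (Complex.ofReal_ne_zero.2 h0)

/-! ### Continuity of the Rayleigh quotient -/

theorem RegTendsto.conj {a : ℕ → LC ℂ} {b : LC ℂ} (h : RegTendsto a b) :
    RegTendsto (fun k => conj (a k)) (conj b) :=
  h.map Complex.continuous_conj

theorem RegTendsto.toComplex_norm2_sq {n : ℕ} {u : ℕ → Fin n → LC ℂ} {v : Fin n → LC ℂ}
    (h : ∀ i, RegTendsto (fun k => u k i) (v i)) :
    RegTendsto (fun k => toComplex (norm2 (u k)) ^ 2) (toComplex (norm2 v) ^ 2) := by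
  simp only [LeviCivita.toComplex_norm2_sq]
  exact RegTendsto.sum _ fun i _ => (h i).conj.mul (h i)

/-- The Rayleigh quotient is continuous along regular sequences of vectors with at most finite
entries, at vectors whose norm is not infinitely small. -/
theorem RegTendsto.rayleigh {n : ℕ} (A : Matrix (Fin n) (Fin n) (LC ℂ))
    {u : ℕ → Fin n → LC ℂ} {v : Fin n → LC ℂ} (h : ∀ i, RegTendsto (fun k => u k i) (v i))
    (hufin : ∀ k i, AtMostFinite (u k i)) (h0 : coeff (toComplex (norm2 v) ^ 2) 0 ≠ 0) :
    RegTendsto (fun k => rayleigh A (u k)) (rayleigh A v) := by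
  have hfin : ∀ k, AtMostFinite (toComplex (norm2 (u k)) ^ 2) := fun k => by
    have hk : AtMostFinite (toComplex (norm2 (u k))) := (atMostFinite_norm2 (hufin k)).map _
    rw [sq]
    exact hk.mul hk
  simp only [LeviCivita.rayleigh, div_eq_mul_inv, dotProduct, Matrix.mulVec]
  refine RegTendsto.mul (RegTendsto.sum _ fun i _ => (h i).conj.mul (RegTendsto.sum _ fun j _ =>
    (regTendsto_const (A i j)).mul (h j))) ?_
  exact (RegTendsto.toComplex_norm2_sq h).inv hfin h0

theorem rayleigh_eigenvector {n : ℕ} {A : Matrix (Fin n) (Fin n) (LC ℂ)} {ν : LC ℂ}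
    {v : Fin n → LC ℂ} (hv : A.mulVec v = ν • v) (h0 : toComplex (norm2 v) ^ 2 ≠ 0) :
    rayleigh A v = ν := by
  rw [rayleigh, hv, dotProduct_smul, dotProduct, ← toComplex_norm2_sq, smul_eq_mul,
    mul_div_cancel_right₀ _ h0]

end LeviCivita

end

theorem proposition4p6 (n : ℕ)
    (A : Matrix (Fin n) (Fin n) (LeviCivita.LC ℂ))
    (hdiag : LeviCivita.Diagonalizable A)
    (hA : ∀ i j, LeviCivita.AtMostFinite (A i j))
    (ν : LeviCivita.LC ℂ) (v : Fin n → LeviCivita.LC ℂ)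
    (hv : Module.End.HasEigenvector (Matrix.toLin' A) ν v)
    (hvfin : ∀ i, LeviCivita.AtMostFinite (v i))
    (hvnorm : 0 < LeviCivita.coeff (LeviCivita.norm2 v) 0)
    (u : ℕ → Fin n → LeviCivita.LC ℂ)
    (hufin : ∀ k i, LeviCivita.AtMostFinite (u k i))
    (hureg : ∀ i, LeviCivita.Regular fun k => u k i)
    (hulim : ∀ i, LeviCivita.WeakTendsto (fun k => u k i) (v i)) :
    (∃ N : ℕ, ∀ k : ℕ, N < k → LeviCivita.norm2 (u k) ≠ 0) ∧
      LeviCivita.WeakTendsto (fun k => LeviCivita.rayleigh A (u k)) ν := by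
  have hlim : ∀ i, LeviCivita.RegTendsto (fun k => u k i) (v i) := fun i =>
    (hulim i).regTendsto (hureg i)
  have h0 := LeviCivita.coeff_toComplex_norm2_sq_ne_zero hvfin hvnorm.ne'
  constructor
  -- The values at `0` of the squared norms converge to a nonzero number, hence are eventually
  -- nonzero.
  · obtain ⟨N, hN⟩ := Filter.eventually_atTop.1
      (((LeviCivita.RegTendsto.toComplex_norm2_sq hlim).2 0).eventually_ne h0)
    refine ⟨N, fun k hk hzero => hN k hk.le ?_⟩
    beta_reduce
    rw [hzero, ← LeviCivita.toComplexHom_apply, map_zero, zero_pow two_ne_zero,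
      LeviCivita.coeff_zero]
  · have hray : LeviCivita.rayleigh A v = ν := by
      refine LeviCivita.rayleigh_eigenvector ?_ fun h => h0 (by rw [h, LeviCivita.coeff_zero])
      rw [← Matrix.toLin'_apply]
      exact hv.apply_eq_smul
    rw [← hray]
    exact (LeviCivita.RegTendsto.rayleigh A hlim hufin h0).weakTendsto
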